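/- For real $\theta,\alpha$ let \[R_y(\theta)=\begin{pmatrix}\cos\frac{\theta}{2}&\sin\frac{\theta}{2}\\-\sin\frac{\theta}{2}&\cos\frac{\theta}{2}\end{pmatrix},\qquad R_z(\alpha)=\begin{pmatrix}e^{-i\alpha/2}&0\\0&e^{i\alpha/2}\end{pmatrix}.\] Order the computational basis of $\mathbb{C}^2\otimes\mathbb{C}^2$ as $|00\rangle,|01\rangle,|10\rangle,|11\rangle$, the first qubit being the top line. The elementary gates on two lines are the following elements of $U(4)$: $R\otimes\mathbf{1}$ and $\mathbf{1}\otimes R$, where $R=R_y(\theta)$ with $0\le\theta<2\pi$ or $R=R_z(\alpha)$ with $0\le\alpha<2\pi$; and the two CNOT gates, namely the one conditioned on the top line (which exchanges $|10\rangle\leftrightarrow|11\rangle$ and fixes $|00\rangle,|01\rangle$) and the one conditioned on the bottom line (which exchanges $|01\rangle\leftrightarrow|11\rangle$ and fixes $|00\rangle,|10\rangle$). **Theorem.** Up to global phase, every two-qubit computation can be realized exactly, without ancilla qubits, by at most $23$ elementary gates, of which at most $4$ are CNOTs. That is, for every $U\in U(4)$ there are an integer $0\le n\le 23$, elementary gates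 $g_1,\dots,g_n$ on the two lines, at most $4$ of which are CNOTs, and a real number $\varphi$ such that $U=e^{i\varphi}\,g_n g_{n-1}\cdots g_1$ (the empty product being $\mathbf{1}$). -/

import Mathlib

open scoped Matrix Kronecker

noncomputable section

namespace TwoQubit

/-- The rotation `R_y(θ)`. -/
def Ry (θ : ℝ) : Matrix (Fin 2) (Fin 2) ℂ :=
  !![(Real.cos (θ / 2) : ℂ), (Real.sin (θ / 2) : ℂ);
     -(Real.sin (θ / 2) : ℂ), (Real.cos (θ / 2) : ℂ)]

/-- The rotation `R_z(α)`. -/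
def Rz (α : ℝ) : Matrix (Fin 2) (Fin 2) ℂ :=
  !![Complex.exp (-(Complex.I * α / 2)), 0;
     0, Complex.exp (Complex.I * α / 2)]

/-- The CNOT gate controlled by the top line, in the basis `|00⟩, |01⟩, |10⟩, |11⟩`
(the top qubit is written first). -/
def topCNOT : Matrix (Fin 4) (Fin 4) ℂ :=
  !![1, 0, 0, 0;
     0, 1, 0, 0;
     0, 0, 0, 1;
     0, 0, 1, 0]

/-- The CNOT gate controlled by the bottom line. -/
def botCNOT : Matrix (Fin 4) (Fin 4) ℂ :=
  !![1, 0, 0, 0;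
     0, 0, 0, 1;
     0, 0, 1, 0;
     0, 1, 0, 0]

/-- The `4 × 4` matrix of `A ⊗ B` (`A` on the top line, `B` on the bottom line), the basis being
ordered lexicographically: the basis vector `|a b⟩` has index `2 * a + b`. -/
def tensor (A B : Matrix (Fin 2) (Fin 2) ℂ) : Matrix (Fin 4) (Fin 4) ℂ :=
  Matrix.reindex (finProdFinEquiv (m := 2) (n := 2)) (finProdFinEquiv (m := 2) (n := 2)) (A ⊗ₖ B)

/-- The two lines of a two-qubit circuit; there is no further line, hence no ancilla. -/
inductive Line : Type
  | top
  | bottom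

/-- A one-qubit computation applied to one of the two lines. -/
def onLine : Line → Matrix (Fin 2) (Fin 2) ℂ → Matrix (Fin 4) (Fin 4) ℂ
  | Line.top, A => tensor A 1
  | Line.bottom, A => tensor 1 A

/-- The elementary gates on two lines: `R_y(θ)` and `R_z(α)` with `0 ≤ θ, α < 2π`
applied to either line, and the CNOT conditioned on either line. -/
inductive Gate : Type
  | ry (l : Line) (θ : ℝ) (h0 : 0 ≤ θ) (h1 : θ < 2 * Real.pi)
  | rz (l : Line) (α : ℝ) (h0 : 0 ≤ α) (h1 : α < 2 * Real.pi)
  | cnot (control : Line)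

/-- The unitary matrix of an elementary gate. -/
def Gate.matrix : Gate → Matrix (Fin 4) (Fin 4) ℂ
  | Gate.ry l θ _ _ => onLine l (Ry θ)
  | Gate.rz l α _ _ => onLine l (Rz α)
  | Gate.cnot Line.top => topCNOT
  | Gate.cnot Line.bottom => botCNOT

/-- Whether an elementary gate is a CNOT. -/
def Gate.isCNOT : Gate → Bool
  | Gate.cnot _ => true
  | _ => false

/-- A two-qubit circuit: the list of its gates in the order in which they are applied. -/
abbrev Circuit : Type := List Gate

/-- The number of elementary gates of a circuit. -/
def Circuit.gateCount (c : Circuit) : ℕ := List.length c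

/-- The number of CNOTs of a circuit. -/
def Circuit.cnotCount (c : Circuit) : ℕ := List.countP Gate.isCNOT c

/-- The computation performed by a circuit: the gate at the head of the list acts first,
so it is the rightmost factor of the matrix product. -/
def Circuit.matrix : Circuit → Matrix (Fin 4) (Fin 4) ℂ
  | [] => 1
  | g :: c => Circuit.matrix c * g.matrix

end TwoQubit

end

/-! In the magic basis the real special orthogonal matrices are exactly of local type `A ⊗ B` with
`A`, `B` in SU(2); only the direction from SO(4) to local gates is needed (`IsSO.isLocal`). Writing
a given unitary in that basis, `M = magicᴴ * U * magic`, the decomposition `M = P D R` with `P`, `R`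
in SO(4) and `D` diagonal (`exists_isSO_mul_diagonal_mul`) makes `U` a product local ·
(magic-diagonal) · local.

The decomposition comes from `MᵀM`, a symmetric unitary: its real and imaginary parts commute, so a
real orthogonal matrix diagonalizes it. Each local factor costs 6 rotations by Euler angles
(`IsSU.realizable_tensor`), and the diagonal factor is an explicit circuit of 7 gates, 4 of them
CNOTs (`realizable_magic_diagonal`). The total is 19 gates. -/

noncomputable section

namespace TwoQubit

/-! ### Circuits with gate budgets, up to global phase -/

/-- `U` is realized up to a global phase by a circuit with at most `n` gates, at most `k` of them
CNOTs. -/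
def Realizable (U : Matrix (Fin 4) (Fin 4) ℂ) (n k : ℕ) : Prop :=
  ∃ c : Circuit, c.gateCount ≤ n ∧ c.cnotCount ≤ k ∧
    ∃ φ : ℝ, U = Complex.exp (Complex.I * φ) • c.matrix

theorem Circuit.matrix_append (c d : Circuit) :
    Circuit.matrix (c ++ d) = Circuit.matrix d * Circuit.matrix c := by
  induction c with
  | nil => simp [Circuit.matrix]
  | cons g c ih => rw [List.cons_append, Circuit.matrix, ih, Circuit.matrix, Matrix.mul_assoc]

theorem Realizable.mul {U V : Matrix (Fin 4) (Fin 4) ℂ} {n m k l : ℕ}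
    (hU : Realizable U n k) (hV : Realizable V m l) : Realizable (U * V) (n + m) (k + l) := by
  obtain ⟨c, hc, hc', φ, rfl⟩ := hU
  obtain ⟨d, hd, hd', ψ, rfl⟩ := hV
  -- The right factor `V` acts first, so its circuit `d` is at the head.
  refine ⟨d ++ c, ?_, ?_, φ + ψ, ?_⟩
  · simp only [Circuit.gateCount, List.length_append] at *
    omega
  · simp only [Circuit.cnotCount, List.countP_append] at *
    omega
  · rw [Circuit.matrix_append, Matrix.smul_mul, Matrix.mul_smul, smul_smul, ← Complex.exp_add]
    push_cast
    ring_nf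

theorem Realizable.smul {U : Matrix (Fin 4) (Fin 4) ℂ} {n k : ℕ} (hU : Realizable U n k)
    (ψ : ℝ) : Realizable (Complex.exp (Complex.I * ψ) • U) n k := by
  obtain ⟨c, hc, hc', φ, rfl⟩ := hU
  refine ⟨c, hc, hc', ψ + φ, ?_⟩
  rw [smul_smul, ← Complex.exp_add]
  push_cast
  ring_nf

/-- A sign is the global phase at angle `π`. This absorbs the sign that appears when a rotation
angle is reduced modulo `2π`. -/
theorem Realizable.neg {U : Matrix (Fin 4) (Fin 4) ℂ} {n k : ℕ} (hU : Realizable U n k) :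
    Realizable (-U) n k := by
  have h := hU.smul Real.pi
  rwa [mul_comm, Complex.exp_pi_mul_I, neg_one_smul] at h

theorem realizable_gate (g : Gate) :
    Realizable g.matrix 1 (if g.isCNOT then 1 else 0) := by
  refine ⟨[g], by simp [Circuit.gateCount], ?_, 0, by simp [Circuit.matrix]⟩
  simp [Circuit.cnotCount, List.countP_cons]

theorem onLine_neg (l : Line) (A : Matrix (Fin 2) (Fin 2) ℂ) : onLine l (-A) = -onLine l A := by
  cases l <;> ext i j <;> simp [onLine, tensor]

theorem tensor_mul (A B A' B' : Matrix (Fin 2) (Fin 2) ℂ) :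
    tensor A B * tensor A' B' = tensor (A * A') (B * B') := by
  simp [tensor, Matrix.mul_kronecker_mul]

theorem onLine_mul (l : Line) (A B : Matrix (Fin 2) (Fin 2) ℂ) :
    onLine l (A * B) = onLine l A * onLine l B := by
  cases l <;> simp [onLine, tensor_mul]

/-- A `2π`-antiperiodic family of one-qubit gates is determined up to sign by its members with
parameter in `[0, 2π)`. -/
theorem exists_mem_Ico_of_antiperiodic {R : ℝ → Matrix (Fin 2) (Fin 2) ℂ}
    (hR : Function.Antiperiodic R (2 * Real.pi)) (θ : ℝ) :
    ∃ θ', 0 ≤ θ' ∧ θ' < 2 * Real.pi ∧ (R θ = R θ' ∨ R θ = -R θ') := by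
  have hp := Real.two_pi_pos
  have hs : ∀ k : ℤ, ∀ x, R (x - k • (2 * Real.pi)) = R x ∨ R (x - k • (2 * Real.pi)) = -R x := by
    intro k x
    rw [hR.sub_zsmul_eq]
    rcases Int.units_eq_one_or (k.negOnePow) with h | h <;> simp [h]
  refine ⟨toIcoMod hp 0 θ, (toIcoMod_mem_Ico hp 0 θ).1, by
    simpa using (toIcoMod_mem_Ico hp 0 θ).2, ?_⟩
  rcases hs (toIcoDiv hp 0 θ) θ with h | h
  · exact Or.inl h.symm
  · exact Or.inr (by rw [toIcoMod, h, neg_neg])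

theorem Ry_antiperiodic : Function.Antiperiodic Ry (2 * Real.pi) := by
  intro θ
  have h : (θ + 2 * Real.pi) / 2 = θ / 2 + Real.pi := by ring
  simp only [Ry, h, Real.cos_add_pi, Real.sin_add_pi]
  ext i j; fin_cases i <;> fin_cases j <;> simp

theorem Rz_antiperiodic : Function.Antiperiodic Rz (2 * Real.pi) := by
  intro θ
  have h : Complex.I * ((θ + 2 * Real.pi : ℝ) : ℂ) / 2 = Complex.I * θ / 2 + Real.pi * Complex.I := by
    push_cast; ring
  simp only [Rz, h, neg_add, Complex.exp_add, Complex.exp_neg, Complex.exp_pi_mul_I]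
  ext i j; fin_cases i <;> fin_cases j <;> simp

theorem realizable_Ry (l : Line) (θ : ℝ) : Realizable (onLine l (Ry θ)) 1 0 := by
  obtain ⟨θ', h0, h1, h⟩ := exists_mem_Ico_of_antiperiodic Ry_antiperiodic θ
  have hg : Realizable (onLine l (Ry θ')) 1 0 := realizable_gate (Gate.ry l θ' h0 h1)
  rcases h with h | h
  · rwa [h]
  · rw [h, onLine_neg]; exact hg.neg

theorem realizable_Rz (l : Line) (α : ℝ) : Realizable (onLine l (Rz α)) 1 0 := by
  obtain ⟨α', h0, h1, h⟩ := exists_mem_Ico_of_antiperiodic Rz_antiperiodic α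
  have hg : Realizable (onLine l (Rz α')) 1 0 := realizable_gate (Gate.rz l α' h0 h1)
  rcases h with h | h
  · rwa [h]
  · rw [h, onLine_neg]; exact hg.neg

/-! ### SU(2) and Euler angles -/

/-- The matrix with first row `(a, b)` of `SU(2)`. -/
def su (a b : ℂ) : Matrix (Fin 2) (Fin 2) ℂ :=
  !![a, b; -(starRingEnd ℂ) b, (starRingEnd ℂ) a]

/-- The special unitary one-qubit computations. -/
def IsSU (A : Matrix (Fin 2) (Fin 2) ℂ) : Prop :=
  ∃ a b : ℂ, a * (starRingEnd ℂ) a + b * (starRingEnd ℂ) b = 1 ∧ A = su a b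

theorem IsSU.mul {A B : Matrix (Fin 2) (Fin 2) ℂ} (hA : IsSU A) (hB : IsSU B) :
    IsSU (A * B) := by
  obtain ⟨a, b, h, rfl⟩ := hA
  obtain ⟨c, d, h', rfl⟩ := hB
  refine ⟨a * c - b * (starRingEnd ℂ) d, a * d + b * (starRingEnd ℂ) c, ?_, ?_⟩
  · simp only [map_sub, map_add, map_mul, Complex.conj_conj]
    linear_combination (c * (starRingEnd ℂ) c + d * (starRingEnd ℂ) d) * h + h'
  · ext i j
    fin_cases i <;> fin_cases j <;> simp [su, Matrix.mul_apply, Fin.sum_univ_two] <;> ring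

theorem IsSU.eq_Rz_mul_Ry_mul_Rz {A : Matrix (Fin 2) (Fin 2) ℂ} (hA : IsSU A) :
    ∃ α θ β : ℝ, A = Rz α * Ry θ * Rz β := by
  obtain ⟨a, b, h, rfl⟩ := hA
  have hn : ‖a‖ ^ 2 + ‖b‖ ^ 2 = 1 := by
    rw [Complex.mul_conj, Complex.mul_conj, Complex.normSq_eq_norm_sq,
      Complex.normSq_eq_norm_sq] at h
    exact_mod_cast h
  obtain ⟨t, hc, hs⟩ : ∃ t : ℝ, Real.cos t = ‖a‖ ∧ Real.sin t = ‖b‖ := by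
    refine ⟨Real.arccos ‖a‖, Real.cos_arccos (by linarith [norm_nonneg a])
      (by nlinarith [norm_nonneg a, sq_nonneg ‖b‖]), ?_⟩
    rw [Real.sin_arccos, show 1 - ‖a‖ ^ 2 = ‖b‖ ^ 2 by linarith, Real.sqrt_sq (norm_nonneg b)]
  have ha : a = Real.cos t * Complex.exp (a.arg * Complex.I) := by
    rw [hc, Complex.norm_mul_exp_arg_mul_I]
  have hb : b = Real.sin t * Complex.exp (b.arg * Complex.I) := by
    rw [hs, Complex.norm_mul_exp_arg_mul_I]
  have hca : (starRingEnd ℂ) a = Real.cos t * Complex.exp (-(a.arg * Complex.I)) := by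
    conv_lhs => rw [ha]
    rw [map_mul, Complex.conj_ofReal, ← Complex.exp_conj, map_mul, Complex.conj_ofReal,
      Complex.conj_I, mul_neg]
  have hcb : (starRingEnd ℂ) b = Real.sin t * Complex.exp (-(b.arg * Complex.I)) := by
    conv_lhs => rw [hb]
    rw [map_mul, Complex.conj_ofReal, ← Complex.exp_conj, map_mul, Complex.conj_ofReal,
      Complex.conj_I, mul_neg]
  -- The first row of `Rz α * Ry (2t) * Rz β` is `e^{-i(α+β)/2} cos t`, `e^{-i(α-β)/2} sin t`;
  -- matching the arguments of `a` and `b` gives `α` and `β`.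
  refine ⟨-(a.arg + b.arg), 2 * t, -(a.arg - b.arg), ?_⟩
  have e : ∀ x y z u : ℂ, u = x + z → Complex.exp x * y * Complex.exp z = y * Complex.exp u := by
    rintro x y z u rfl
    rw [Complex.exp_add]; ring
  have h2 : 2 * t / 2 = t := by ring
  ext i j
  fin_cases i <;> fin_cases j <;>
    simp only [su, Rz, Ry, h2, Matrix.mul_apply, Fin.sum_univ_two, Matrix.of_apply,
      Matrix.cons_val', Matrix.cons_val_zero, Matrix.cons_val_one, Matrix.cons_val_fin_one,
      Fin.zero_eta, Fin.mk_one, mul_zero, zero_mul, add_zero, zero_add, Fin.isValue]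
  · rw [e _ _ _ (a.arg * Complex.I) (by push_cast; ring)]; exact ha
  · rw [e _ _ _ (b.arg * Complex.I) (by push_cast; ring)]; exact hb
  · rw [e _ _ _ (-(b.arg * Complex.I)) (by push_cast; ring), hcb]; ring
  · rw [e _ _ _ (-(a.arg * Complex.I)) (by push_cast; ring), hca]

theorem IsSU.realizable_onLine {A : Matrix (Fin 2) (Fin 2) ℂ} (hA : IsSU A) (l : Line) :
    Realizable (onLine l A) 3 0 := by
  obtain ⟨α, θ, β, rfl⟩ := hA.eq_Rz_mul_Ry_mul_Rz
  rw [onLine_mul, onLine_mul]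
  exact ((realizable_Rz l α).mul (realizable_Ry l θ)).mul (realizable_Rz l β)

theorem IsSU.realizable_tensor {A B : Matrix (Fin 2) (Fin 2) ℂ} (hA : IsSU A) (hB : IsSU B) :
    Realizable (tensor A B) 6 0 := by
  have h := (hA.realizable_onLine Line.top).mul (hB.realizable_onLine Line.bottom)
  rwa [onLine, onLine, tensor_mul, mul_one, one_mul] at h

/-! ### The magic basis and local gates -/

/-- The magic basis, the vectors being the columns. -/
def magic : Matrix (Fin 4) (Fin 4) ℂ :=
  !![(1 + Complex.I) / 2, (1 - Complex.I) / 2, 0, 0;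
     0, 0, (1 - Complex.I) / 2, (1 + Complex.I) / 2;
     0, 0, (1 + Complex.I) / 2, (1 - Complex.I) / 2;
     (-1 + Complex.I) / 2, (-1 - Complex.I) / 2, 0, 0]

theorem magic_mul_conjTranspose : magic * magicᴴ = 1 := by
  have hI := Complex.I_sq
  have h2 : (starRingEnd ℂ) 2 = 2 := Complex.conj_ofNat 2
  ext i j
  fin_cases i <;> fin_cases j <;>
    simp [magic, Matrix.mul_apply, Fin.sum_univ_four, h2] <;> grind

theorem tensor_eq (a b c d e f g h : ℂ) :
    tensor !![a, b; c, d] !![e, f; g, h] =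
      !![a * e, a * f, b * e, b * f; a * g, a * h, b * g, b * h;
         c * e, c * f, d * e, d * f; c * g, c * h, d * g, d * h] := by
  ext i j
  fin_cases i <;> fin_cases j <;> rfl

/-- The real matrices which represent local computations in the magic basis. -/
def IsLocal (P : Matrix (Fin 4) (Fin 4) ℝ) : Prop :=
  ∃ A B, IsSU A ∧ IsSU B ∧ magic * P.map (algebraMap ℝ ℂ) = tensor A B * magic

theorem IsLocal.mul {P R : Matrix (Fin 4) (Fin 4) ℝ} (hP : IsLocal P) (hR : IsLocal R) :
    IsLocal (P * R) := by
  obtain ⟨A, B, hA, hB, h⟩ := hP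
  obtain ⟨A', B', hA', hB', h'⟩ := hR
  refine ⟨A * A', B * B', hA.mul hA', hB.mul hB', ?_⟩
  rw [Matrix.map_mul, ← tensor_mul, ← Matrix.mul_assoc, h, Matrix.mul_assoc, h', Matrix.mul_assoc]

/-- The rotations of the plane of two consecutive coordinates. -/
def givens : Fin 3 → ℝ → ℝ → Matrix (Fin 4) (Fin 4) ℝ
  | 0, c, s => !![c, s, 0, 0; -s, c, 0, 0; 0, 0, 1, 0; 0, 0, 0, 1]
  | 1, c, s => !![1, 0, 0, 0; 0, c, s, 0; 0, -s, c, 0; 0, 0, 0, 1]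
  | 2, c, s => !![1, 0, 0, 0; 0, 1, 0, 0; 0, 0, c, s; 0, 0, -s, c]

theorem exists_half_angle {c s : ℝ} (h : c ^ 2 + s ^ 2 = 1) :
    ∃ p q : ℝ, p ^ 2 + q ^ 2 = 1 ∧ c = p ^ 2 - q ^ 2 ∧ s = 2 * p * q := by
  have hn : ‖(⟨c, s⟩ : ℂ)‖ = 1 := by
    rw [Complex.norm_def, Complex.normSq_mk, ← sq, ← sq, h, Real.sqrt_one]
  have e := Complex.norm_mul_exp_arg_mul_I ⟨c, s⟩
  rw [hn, Complex.ofReal_one, one_mul] at e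
  set t := Complex.arg ⟨c, s⟩
  have hc : c = Real.cos t := by rw [← Complex.exp_ofReal_mul_I_re, e]
  have hs : s = Real.sin t := by rw [← Complex.exp_ofReal_mul_I_im, e]
  refine ⟨Real.cos (t / 2), Real.sin (t / 2), Real.cos_sq_add_sin_sq _, ?_, ?_⟩
  · rw [hc, ← Real.cos_two_mul', mul_div_cancel₀ t two_ne_zero]
  · rw [hs, mul_right_comm, ← Real.sin_two_mul, mul_div_cancel₀ t two_ne_zero]

/-- With half angle `u`, `p = cos u` and `q = sin u`, the three rotations come from `e^{iuZ} ⊗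
e^{iuZ}`, `e^{-iuX} ⊗ e^{iuY}` and `e^{-iuZ} ⊗ e^{iuZ}`. The half angle reflects the double cover of
SO(4) by SU(2) × SU(2). -/
theorem isLocal_givens (k : Fin 3) {c s : ℝ} (h : c ^ 2 + s ^ 2 = 1) :
    IsLocal (givens k c s) := by
  obtain ⟨p, q, hpq, rfl, rfl⟩ := exists_half_angle h
  have hI := Complex.I_sq
  have hpq' : (p : ℂ) ^ 2 + (q : ℂ) ^ 2 = 1 := by exact_mod_cast hpq
  fin_cases k
  · refine ⟨su (p + q * Complex.I) 0, su (p + q * Complex.I) 0, ⟨_, _, ?_, rfl⟩,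
      ⟨_, _, ?_, rfl⟩, ?_⟩
    · simp; linear_combination hpq' - q ^ 2 * hI
    · simp; linear_combination hpq' - q ^ 2 * hI
    · rw [su, tensor_eq]
      ext i j
      fin_cases i <;> fin_cases j <;>
        simp [magic, givens, Matrix.mul_apply, Fin.sum_univ_four] <;> grind
  · refine ⟨su p (-(q * Complex.I)), su p q, ⟨_, _, ?_, rfl⟩,
      ⟨_, _, ?_, rfl⟩, ?_⟩
    · simp; linear_combination hpq' - q ^ 2 * hI
    · simp; linear_combination hpq'
    · rw [su, su, tensor_eq]
      ext i j
      fin_cases i <;> fin_cases j <;>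
        simp [magic, givens, Matrix.mul_apply, Fin.sum_univ_four] <;> grind
  · refine ⟨su (p - q * Complex.I) 0, su (p + q * Complex.I) 0, ⟨_, _, ?_, rfl⟩,
      ⟨_, _, ?_, rfl⟩, ?_⟩
    · simp; linear_combination hpq' - q ^ 2 * hI
    · simp; linear_combination hpq' - q ^ 2 * hI
    · rw [su, su, tensor_eq]
      ext i j
      fin_cases i <;> fin_cases j <;>
        simp [magic, givens, Matrix.mul_apply, Fin.sum_univ_four] <;> grind

/-! ### Givens reduction: SO(4) is local in the magic basis -/

/-- The special orthogonal matrices. -/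
def IsSO (P : Matrix (Fin 4) (Fin 4) ℝ) : Prop := Pᵀ * P = 1 ∧ P.det = 1

theorem IsSO.mul {P R : Matrix (Fin 4) (Fin 4) ℝ} (hP : IsSO P) (hR : IsSO R) :
    IsSO (P * R) := by
  refine ⟨?_, by rw [Matrix.det_mul, hP.2, hR.2, one_mul]⟩
  rw [Matrix.transpose_mul, Matrix.mul_assoc, ← Matrix.mul_assoc Pᵀ, hP.1, Matrix.one_mul, hR.1]

theorem isSO_givens (k : Fin 3) {c s : ℝ} (h : c ^ 2 + s ^ 2 = 1) : IsSO (givens k c s) := by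
  constructor
  · fin_cases k <;> ext i j <;> fin_cases i <;> fin_cases j <;>
      simp [givens, Matrix.mul_apply, Fin.sum_univ_four] <;>
      grind
  · fin_cases k <;>
      simp [givens, Matrix.det_succ_row_zero, Fin.sum_univ_succ, Fin.succAbove] <;>
      linear_combination h

theorem givens_neg_mul (k : Fin 3) {c s : ℝ} (h : c ^ 2 + s ^ 2 = 1) :
    givens k c (-s) * givens k c s = 1 := by
  fin_cases k <;> ext i j <;> fin_cases i <;> fin_cases j <;>
    simp [givens, Matrix.mul_apply, Fin.sum_univ_four] <;>
    grind

theorem IsLocal.of_givens_mul (k : Fin 3) {c s : ℝ} (h : c ^ 2 + s ^ 2 = 1)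
    {P : Matrix (Fin 4) (Fin 4) ℝ} (hP : IsLocal (givens k c s * P)) : IsLocal P := by
  have := (isLocal_givens k (c := c) (s := -s) (by rw [neg_sq, h])).mul hP
  rwa [← Matrix.mul_assoc, givens_neg_mul k h, Matrix.one_mul] at this

theorem exists_rotation (x y : ℝ) :
    ∃ c s : ℝ, c ^ 2 + s ^ 2 = 1 ∧ 0 ≤ c * x + s * y ∧ -s * x + c * y = 0 := by
  have hx := Complex.norm_mul_cos_arg ⟨x, y⟩
  have hy := Complex.norm_mul_sin_arg ⟨x, y⟩
  have h := Real.cos_sq_add_sin_sq (Complex.arg ⟨x, y⟩)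
  have hn := norm_nonneg (⟨x, y⟩ : ℂ)
  refine ⟨_, _, h, ?_, ?_⟩
  · linear_combination hn - ‖(⟨x, y⟩ : ℂ)‖ * h + Real.cos (Complex.arg ⟨x, y⟩) * hx +
      Real.sin (Complex.arg ⟨x, y⟩) * hy
  · linear_combination Real.sin (Complex.arg ⟨x, y⟩) * hx - Real.cos (Complex.arg ⟨x, y⟩) * hy

/-- An upper triangular special orthogonal matrix whose diagonal, up to the last entry, is
nonnegative is the identity. -/
theorem IsSO.eq_one {P : Matrix (Fin 4) (Fin 4) ℝ} (hP : IsSO P)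
    (h10 : P 1 0 = 0) (h20 : P 2 0 = 0) (h30 : P 3 0 = 0) (h21 : P 2 1 = 0) (h31 : P 3 1 = 0)
    (h32 : P 3 2 = 0) (h0 : 0 ≤ P 0 0) (h1 : 0 ≤ P 1 1) (h2 : 0 ≤ P 2 2) : P = 1 := by
  obtain ⟨ho, hd⟩ := hP
  have e : ∀ i j, P 0 i * P 0 j + P 1 i * P 1 j + P 2 i * P 2 j + P 3 i * P 3 j =
      (1 : Matrix (Fin 4) (Fin 4) ℝ) i j := by
    intro i j
    rw [← ho]
    simp [Matrix.mul_apply, Fin.sum_univ_four]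
  have a00 : P 0 0 = 1 := by
    have := e 0 0
    simp [h10, h20, h30] at this
    nlinarith
  have a01 : P 0 1 = 0 := by simpa [h10, h20, h30, a00] using e 0 1
  have a02 : P 0 2 = 0 := by simpa [h10, h20, h30, a00] using e 0 2
  have a03 : P 0 3 = 0 := by simpa [h10, h20, h30, a00] using e 0 3
  have a11 : P 1 1 = 1 := by
    have := e 1 1
    simp [a01, h21, h31] at this
    nlinarith
  have a12 : P 1 2 = 0 := by simpa [a01, h21, h31, a11] using e 1 2
  have a13 : P 1 3 = 0 := by simpa [a01, h21, h31, a11] using e 1 3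
  have a22 : P 2 2 = 1 := by
    have := e 2 2
    simp [a02, a12, h32] at this
    nlinarith
  have a23 : P 2 3 = 0 := by simpa [a02, a12, h32, a22] using e 2 3
  -- Orthogonality leaves the sign of the last entry open; the determinant fixes it.
  have a33 : P 3 3 = 1 := by
    rw [Matrix.det_of_isUpperTriangular (by
      intro i j hij
      fin_cases i <;> fin_cases j <;> first | assumption | simp at hij)] at hd
    simpa [Fin.prod_univ_four, a00, a11, a22] using hd
  ext i j
  fin_cases i <;> fin_cases j <;> simp [*]

theorem isLocal_one : IsLocal 1 := by
  have h : IsSU 1 := ⟨1, 0, by simp, by ext i j; fin_cases i <;> fin_cases j <;> simp [su]⟩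
  refine ⟨1, 1, h, h, ?_⟩
  simp [tensor]

/-- QR reduction: six local Givens rotations clear the entries below the diagonal. The last rotation
in each column also makes the pivot nonnegative, so what remains is the identity by `IsSO.eq_one`.
-/
theorem IsSO.isLocal {P : Matrix (Fin 4) (Fin 4) ℝ} (hP : IsSO P) : IsLocal P := by
  obtain ⟨c, s, h, -, e⟩ := exists_rotation (P 2 0) (P 3 0)
  refine IsLocal.of_givens_mul 2 h ?_
  have hP := (isSO_givens 2 h).mul hP
  have a30 : (givens 2 c s * P) 3 0 = 0 := by
    simpa [givens, Matrix.mul_apply, Fin.sum_univ_four] using e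
  generalize givens 2 c s * P = P at *
  clear e h c s
  obtain ⟨c, s, h, -, e⟩ := exists_rotation (P 1 0) (P 2 0)
  refine IsLocal.of_givens_mul 1 h ?_
  have hP := (isSO_givens 1 h).mul hP
  have a30 : (givens 1 c s * P) 3 0 = 0 := by
    simpa [givens, Matrix.mul_apply, Fin.sum_univ_four] using a30
  have a20 : (givens 1 c s * P) 2 0 = 0 := by
    simpa [givens, Matrix.mul_apply, Fin.sum_univ_four] using e
  generalize givens 1 c s * P = P at *
  clear e h c s
  obtain ⟨c, s, h, d, e⟩ := exists_rotation (P 0 0) (P 1 0)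
  refine IsLocal.of_givens_mul 0 h ?_
  have hP := (isSO_givens 0 h).mul hP
  have a30 : (givens 0 c s * P) 3 0 = 0 := by
    simpa [givens, Matrix.mul_apply, Fin.sum_univ_four] using a30
  have a20 : (givens 0 c s * P) 2 0 = 0 := by
    simpa [givens, Matrix.mul_apply, Fin.sum_univ_four] using a20
  have a10 : (givens 0 c s * P) 1 0 = 0 := by
    simpa [givens, Matrix.mul_apply, Fin.sum_univ_four] using e
  have a00 : 0 ≤ (givens 0 c s * P) 0 0 := by
    simpa [givens, Matrix.mul_apply, Fin.sum_univ_four] using d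
  generalize givens 0 c s * P = P at *
  clear d e h c s
  -- Second column: the rows mixed from here on already vanish in the first column, so its zeros
  -- survive.
  obtain ⟨c, s, h, -, e⟩ := exists_rotation (P 2 1) (P 3 1)
  refine IsLocal.of_givens_mul 2 h ?_
  have hP := (isSO_givens 2 h).mul hP
  have a30 : (givens 2 c s * P) 3 0 = 0 := by
    simp [givens, Matrix.mul_apply, Fin.sum_univ_four, a20, a30]
  have a20 : (givens 2 c s * P) 2 0 = 0 := by
    simp_all [givens, Matrix.mul_apply, Fin.sum_univ_four]
  have a10 : (givens 2 c s * P) 1 0 = 0 := by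
    simpa [givens, Matrix.mul_apply, Fin.sum_univ_four] using a10
  have a00 : 0 ≤ (givens 2 c s * P) 0 0 := by
    simpa [givens, Matrix.mul_apply, Fin.sum_univ_four] using a00
  have a31 : (givens 2 c s * P) 3 1 = 0 := by
    simpa [givens, Matrix.mul_apply, Fin.sum_univ_four] using e
  generalize givens 2 c s * P = P at *
  clear e h c s
  obtain ⟨c, s, h, d, e⟩ := exists_rotation (P 1 1) (P 2 1)
  refine IsLocal.of_givens_mul 1 h ?_
  have hP := (isSO_givens 1 h).mul hP
  have b30 : (givens 1 c s * P) 3 0 = 0 := by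
    simpa [givens, Matrix.mul_apply, Fin.sum_univ_four] using a30
  have b20 : (givens 1 c s * P) 2 0 = 0 := by
    simp [givens, Matrix.mul_apply, Fin.sum_univ_four, a10, a20]
  have b10 : (givens 1 c s * P) 1 0 = 0 := by
    simp [givens, Matrix.mul_apply, Fin.sum_univ_four, a10, a20]
  have b00 : 0 ≤ (givens 1 c s * P) 0 0 := by
    simpa [givens, Matrix.mul_apply, Fin.sum_univ_four] using a00
  have b31 : (givens 1 c s * P) 3 1 = 0 := by
    simpa [givens, Matrix.mul_apply, Fin.sum_univ_four] using a31
  have b21 : (givens 1 c s * P) 2 1 = 0 := by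
    simpa [givens, Matrix.mul_apply, Fin.sum_univ_four] using e
  have b11 : 0 ≤ (givens 1 c s * P) 1 1 := by
    simpa [givens, Matrix.mul_apply, Fin.sum_univ_four] using d
  clear a30 a20 a10 a00 a31
  generalize givens 1 c s * P = P at *
  clear d e h c s
  obtain ⟨c, s, h, d, e⟩ := exists_rotation (P 2 2) (P 3 2)
  refine IsLocal.of_givens_mul 2 h ?_
  have hP := (isSO_givens 2 h).mul hP
  rw [hP.eq_one]
  · exact isLocal_one
  all_goals simp [givens, Matrix.mul_apply, Fin.sum_univ_four, *]
  linear_combination e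

/-! ### Magic-diagonal gates as circuits -/

/-- Conjugation by the CNOTs turns the three rotations into the exponential of `(i/2)(a Y⊗X + b X⊗Y
− c Z⊗Z)`. These Pauli products commute, and the magic vectors are their joint eigenvectors. -/
theorem entangler_mul_magic (a b c : ℝ) :
    topCNOT * onLine Line.top (Ry a) * onLine Line.bottom (Rz c) * botCNOT *
      onLine Line.top (Ry b) * botCNOT * topCNOT * magic =
    magic * Matrix.diagonal
      ![Complex.exp (Complex.I * ((a + b - c) / 2 : ℝ)),
        Complex.exp (Complex.I * ((-a - b - c) / 2 : ℝ)),
        Complex.exp (Complex.I * ((a - b + c) / 2 : ℝ)),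
        Complex.exp (Complex.I * ((-a + b + c) / 2 : ℝ))] := by
  have hI := Complex.I_sq
  have hy : ∀ t : ℝ, Complex.exp (Complex.I * (t / 2)) =
      Real.cos (t / 2) + Real.sin (t / 2) * Complex.I := by
    intro t
    rw [mul_comm]
    have := Complex.exp_mul_I ((t / 2 : ℝ) : ℂ)
    push_cast at this ⊢
    exact this
  have hy' : ∀ t : ℝ, Complex.exp (-(Complex.I * (t / 2))) =
      Real.cos (t / 2) - Real.sin (t / 2) * Complex.I := by
    intro t
    have := hy (-t)
    simp only [neg_div, Real.cos_neg, Real.sin_neg, Complex.ofReal_neg, mul_neg] at this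
    rw [this]; ring
  have e0 : Complex.exp (Complex.I * ((a + b - c) / 2 : ℝ)) =
      Complex.exp (Complex.I * (a / 2)) * Complex.exp (Complex.I * (b / 2)) *
        Complex.exp (-(Complex.I * c / 2)) := by
    rw [← Complex.exp_add, ← Complex.exp_add]; push_cast; ring_nf
  have e1 : Complex.exp (Complex.I * ((-a - b - c) / 2 : ℝ)) =
      Complex.exp (-(Complex.I * (a / 2))) * Complex.exp (-(Complex.I * (b / 2))) *
        Complex.exp (-(Complex.I * c / 2)) := by
    rw [← Complex.exp_add, ← Complex.exp_add]; push_cast; ring_nf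
  have e2 : Complex.exp (Complex.I * ((a - b + c) / 2 : ℝ)) =
      Complex.exp (Complex.I * (a / 2)) * Complex.exp (-(Complex.I * (b / 2))) *
        Complex.exp (Complex.I * c / 2) := by
    rw [← Complex.exp_add, ← Complex.exp_add]; push_cast; ring_nf
  have e3 : Complex.exp (Complex.I * ((-a + b + c) / 2 : ℝ)) =
      Complex.exp (-(Complex.I * (a / 2))) * Complex.exp (Complex.I * (b / 2)) *
        Complex.exp (Complex.I * c / 2) := by
    rw [← Complex.exp_add, ← Complex.exp_add]; push_cast; ring_nf
  rw [e0, e1, e2, e3, hy, hy, hy', hy']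
  simp only [onLine, Ry, Rz, Matrix.one_fin_two, tensor_eq]
  generalize (Real.cos (a / 2) : ℂ) = ca
  generalize (Real.sin (a / 2) : ℂ) = sa
  generalize (Real.cos (b / 2) : ℂ) = cb
  generalize (Real.sin (b / 2) : ℂ) = sb
  generalize Complex.exp (-(Complex.I * c / 2)) = z
  generalize Complex.exp (Complex.I * c / 2) = w
  simp only [topCNOT, botCNOT, magic]
  ext i j
  fin_cases i <;> fin_cases j <;>
    simp [Matrix.mul_apply, Fin.sum_univ_four] <;> grind

/-- The diagonal computations in the magic basis. -/
theorem realizable_magic_diagonal (δ : Fin 4 → ℝ) :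
    Realizable (magic * Matrix.diagonal (fun i => Complex.exp (Complex.I * δ i)) * magicᴴ) 7 4 := by
  have ht : Realizable topCNOT 1 1 := realizable_gate (Gate.cnot Line.top)
  have hb : Realizable botCNOT 1 1 := realizable_gate (Gate.cnot Line.bottom)
  -- `φ` is the mean phase; `a`, `b`, `c` solve the linear system equating the phases of
  -- `entangler_mul_magic` with `δ i - φ`.
  let a := (δ 0 - δ 1 + δ 2 - δ 3) / 2
  let b := (δ 0 - δ 1 - δ 2 + δ 3) / 2
  let c := -(δ 0 + δ 1 - δ 2 - δ 3) / 2
  let φ := (δ 0 + δ 1 + δ 2 + δ 3) / 4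
  have h := ((((((ht.mul (realizable_Ry Line.top a)).mul (realizable_Rz Line.bottom c)).mul
    hb).mul (realizable_Ry Line.top b)).mul hb).mul ht).smul φ
  convert h using 1
  rw [← Matrix.mul_one (_ * topCNOT), ← magic_mul_conjTranspose, ← Matrix.mul_assoc,
    entangler_mul_magic, ← Matrix.smul_mul, ← Matrix.mul_smul, ← Matrix.diagonal_smul]
  congr 3
  ext i
  rw [Pi.smul_apply, smul_eq_mul]
  fin_cases i <;> simp only [Matrix.cons_val_zero, Matrix.cons_val_one, Matrix.cons_val,
    Fin.zero_eta, Fin.mk_one, Fin.reduceFinMk] <;> rw [← Complex.exp_add] <;> congr 1 <;>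
    simp only [a, b, c, φ] <;> push_cast <;> ring

/-! ### Orthogonal diagonalization and the decomposition `P D R` -/

open Module.End in
/-- Two commuting real symmetric matrices are diagonalized by a common orthogonal matrix. -/
theorem exists_orthogonal_simultaneous_diagonalization {n : ℕ} {X Y : Matrix (Fin n) (Fin n) ℝ}
    (hX : Xᵀ = X) (hY : Yᵀ = Y) (hXY : X * Y = Y * X) :
    ∃ (V : Matrix (Fin n) (Fin n) ℝ) (x y : Fin n → ℝ), Vᵀ * V = 1 ∧
      X * V = V * Matrix.diagonal x ∧ Y * V = V * Matrix.diagonal y := by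
  classical
  let A := Matrix.toEuclideanLin X
  let B := Matrix.toEuclideanLin Y
  have hA : A.IsSymmetric := Matrix.isSymmetric_toEuclideanLin_iff.mpr (by
    rw [Matrix.IsHermitian, Matrix.conjTranspose_eq_transpose_of_trivial, hX])
  have hB : B.IsSymmetric := Matrix.isSymmetric_toEuclideanLin_iff.mpr (by
    rw [Matrix.IsHermitian, Matrix.conjTranspose_eq_transpose_of_trivial, hY])
  have hAB : Commute A B := by
    refine LinearMap.ext fun v => ?_
    simp [A, B, Matrix.toLpLin_apply, Matrix.mulVec_mulVec, hXY]
  -- Indexing by actual eigenvalues instead of all reals keeps the family finite; the omitted joint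
  -- eigenspaces are zero.
  let W : Eigenvalues B × Eigenvalues A → Submodule ℝ (EuclideanSpace ℝ (Fin n)) :=
    fun i => eigenspace A i.2 ⊓ eigenspace B i.1
  have hW : OrthogonalFamily ℝ (fun i => W i) fun i => (W i).subtypeₗᵢ :=
    (hA.orthogonalFamily_eigenspace_inf_eigenspace hB).comp
      (γ := Eigenvalues B × Eigenvalues A) (f := fun i => ((i.1 : ℝ), (i.2 : ℝ)))
      (fun i j h => by
        simp only [Prod.mk.injEq] at h
        exact Prod.ext (Subtype.ext h.1) (Subtype.ext h.2))
  have hWtop : DirectSum.IsInternal W := by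
    rw [hW.isInternal_iff, Submodule.orthogonal_eq_bot_iff, eq_top_iff,
      ← hA.iSup_iSup_eigenspace_inf_eigenspace_eq_top_of_commute hB hAB]
    refine iSup_le fun a => iSup_le fun b => ?_
    by_cases ha : HasEigenvalue A a
    · by_cases hb : HasEigenvalue B b
      · exact le_iSup W (⟨b, hb⟩, ⟨a, ha⟩)
      · rw [HasEigenvalue, HasUnifEigenvalue, not_not] at hb
        exact inf_le_right.trans (hb.le.trans bot_le)
    · rw [HasEigenvalue, HasUnifEigenvalue, not_not] at ha
      exact inf_le_left.trans (ha.le.trans bot_le)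
  have hn : Module.finrank ℝ (EuclideanSpace ℝ (Fin n)) = n := by simp
  obtain ⟨b, x, y, hbx, hby⟩ : ∃ (b : OrthonormalBasis (Fin n) ℝ (EuclideanSpace ℝ (Fin n)))
      (x y : Fin n → ℝ), (∀ i, A (b i) = x i • b i) ∧ ∀ i, B (b i) = y i • b i := by
    let ι := fun i => hWtop.subordinateOrthonormalBasisIndex hn i hW
    have hb : ∀ i, hWtop.subordinateOrthonormalBasis hn hW i ∈ W (ι i) := fun i =>
      hWtop.subordinateOrthonormalBasis_subordinate hn i hW
    exact ⟨_, fun i => (ι i).2, fun i => (ι i).1, fun i => mem_eigenspace_iff.mp (hb i).1,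
      fun i => mem_eigenspace_iff.mp (hb i).2⟩
  have key : ∀ (Z : Matrix (Fin n) (Fin n) ℝ) (z : Fin n → ℝ),
      (∀ i, Matrix.toEuclideanLin Z (b i) = z i • b i) →
      Z * (Matrix.of fun i j => b j i) = (Matrix.of fun i j => b j i) * Matrix.diagonal z := by
    intro Z z h
    ext i j
    rw [Matrix.mul_diagonal, Matrix.mul_apply, Matrix.of_apply, mul_comm]
    exact congrArg (fun v : EuclideanSpace ℝ (Fin n) => v i) (h j)
  refine ⟨Matrix.of fun i j => b j i, x, y, ?_, key X x hbx, key Y y hby⟩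
  ext i j
  have h := orthonormal_iff_ite.mp b.orthonormal i j
  rw [PiLp.inner_apply] at h
  simp only [Matrix.mul_apply, Matrix.transpose_apply, Matrix.of_apply, Matrix.one_apply, ← h]
  exact Finset.sum_congr rfl fun k _ => by simp [mul_comm]

theorem exists_sign_isSO {P : Matrix (Fin 4) (Fin 4) ℝ} (hP : Pᵀ * P = 1) :
    ∃ J : Fin 4 → ℝ, (∀ i, J i = 1 ∨ J i = -1) ∧ IsSO (P * Matrix.diagonal J) := by
  have hd : P.det = 1 ∨ P.det = -1 := by
    have h := congrArg Matrix.det hP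
    rw [Matrix.det_mul, Matrix.det_transpose, Matrix.det_one] at h
    exact mul_self_eq_one_iff.mp h
  -- Scaling the first column by the determinant `±1` corrects the orientation.
  have hJ : ∀ i, (![P.det, 1, 1, 1] : Fin 4 → ℝ) i = 1 ∨
      (![P.det, 1, 1, 1] : Fin 4 → ℝ) i = -1 := by
    intro i
    fin_cases i
    · exact hd
    all_goals exact Or.inl rfl
  refine ⟨_, hJ, ?_, ?_⟩
  · rw [Matrix.transpose_mul, Matrix.diagonal_transpose, Matrix.mul_assoc,
      ← Matrix.mul_assoc Pᵀ, hP, Matrix.one_mul, Matrix.diagonal_mul_diagonal,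
      ← Matrix.diagonal_one]
    congr 1
    ext i
    rcases hJ i with h | h <;> simp [h]
  · rw [Matrix.det_mul, Matrix.det_diagonal, Fin.prod_univ_four]
    rcases hd with h | h <;> simp [h]

theorem map_algebraMap_injective {n : Type*} :
    Function.Injective fun P : Matrix n n ℝ => P.map (algebraMap ℝ ℂ) :=
  Matrix.map_injective Complex.ofReal_injective

theorem transpose_mul_map_algebraMap {n : Type*} [Fintype n] [DecidableEq n] {P : Matrix n n ℝ} :
    (P.map (algebraMap ℝ ℂ))ᵀ * P.map (algebraMap ℝ ℂ) = 1 ↔ Pᵀ * P = 1 := by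
  rw [← Matrix.transpose_map, ← Matrix.map_mul, ← map_algebraMap_injective.eq_iff]
  simp

/-- A symmetric unitary matrix is diagonalized by a real orthogonal matrix. -/
theorem exists_orthogonal_diagonalization_of_symmetric_unitary {n : ℕ}
    {S : Matrix (Fin n) (Fin n) ℂ} (hS : Sᵀ = S) (hS' : Sᴴ * S = 1) :
    ∃ (V : Matrix (Fin n) (Fin n) ℝ) (d : Fin n → ℂ), Vᵀ * V = 1 ∧
      S * V.map (algebraMap ℝ ℂ) = V.map (algebraMap ℝ ℂ) * Matrix.diagonal d := by
  let X := S.map Complex.re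
  let Y := S.map Complex.im
  have hX : Xᵀ = X := Matrix.transpose_map.symm.trans (by rw [hS])
  have hY : Yᵀ = Y := Matrix.transpose_map.symm.trans (by rw [hS])
  have e : S = X.map (algebraMap ℝ ℂ) + Complex.I • Y.map (algebraMap ℝ ℂ) := by
    ext i j
    simp [X, Y, mul_comm Complex.I, Complex.re_add_im]
  have e' : Sᴴ = X.map (algebraMap ℝ ℂ) - Complex.I • Y.map (algebraMap ℝ ℂ) := by
    ext i j
    rw [Matrix.conjTranspose_apply, ← Matrix.transpose_apply S, hS]
    apply Complex.ext <;> simp [X, Y]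
  have hXY : X * Y = Y * X := by
    apply map_algebraMap_injective
    simp only [Matrix.map_mul]
    -- In `SᴴS = SSᴴ`, symmetry gives `Sᴴ = X - iY`; the squares cancel and `2iXY = 2iYX` remains.
    have h := hS'.trans (mul_eq_one_comm.mp hS').symm
    rw [e', e] at h
    simp only [add_mul, mul_add, sub_mul, mul_sub, Matrix.smul_mul, Matrix.mul_smul] at h
    have h' : (2 * Complex.I) • (X.map (algebraMap ℝ ℂ) * Y.map (algebraMap ℝ ℂ)) =
        (2 * Complex.I) • (Y.map (algebraMap ℝ ℂ) * X.map (algebraMap ℝ ℂ)) := by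
      rw [mul_smul, mul_smul, two_smul, two_smul]
      have h2 := sub_eq_zero.mpr h
      rw [← sub_eq_zero, ← h2]
      abel
    exact smul_right_injective _ (by simp) h'
  obtain ⟨V, x, y, hV, hx, hy⟩ := exists_orthogonal_simultaneous_diagonalization hX hY hXY
  refine ⟨V, fun i => x i + Complex.I * y i, hV, ?_⟩
  have hx' := congrArg (fun P => P.map (algebraMap ℝ ℂ)) hx
  have hy' := congrArg (fun P => P.map (algebraMap ℝ ℂ)) hy
  simp only [Matrix.map_mul] at hx' hy'
  rw [e, add_mul, Matrix.smul_mul, hx', hy', ← Matrix.mul_smul, ← mul_add]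
  congr 1
  ext i j
  by_cases h : i = j <;> simp [h]

/-- Every unitary matrix is a product `O₁ D O₂` with `O₁`, `O₂` special orthogonal and `D` a
diagonal matrix of phases. -/
theorem exists_isSO_mul_diagonal_mul {M : Matrix (Fin 4) (Fin 4) ℂ} (hM : Mᴴ * M = 1) :
    ∃ (P R : Matrix (Fin 4) (Fin 4) ℝ) (δ : Fin 4 → ℝ), IsSO P ∧ IsSO R ∧
      M = P.map (algebraMap ℝ ℂ) * Matrix.diagonal (fun i => Complex.exp (Complex.I * δ i)) *
        R.map (algebraMap ℝ ℂ) := by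
  have hS : (Mᵀ * M)ᴴ * (Mᵀ * M) = 1 := by
    have h : Mᵀᴴ * Mᵀ = 1 := by
      rw [show Mᵀᴴ = Mᴴᵀ from rfl, ← Matrix.transpose_mul, mul_eq_one_comm.mp hM,
        Matrix.transpose_one]
    rw [Matrix.conjTranspose_mul, Matrix.mul_assoc, ← Matrix.mul_assoc Mᵀᴴ, h, Matrix.one_mul, hM]
  obtain ⟨V, d, hV, hd⟩ := exists_orthogonal_diagonalization_of_symmetric_unitary
    (by rw [Matrix.transpose_mul, Matrix.transpose_transpose]) hS
  obtain ⟨J, -, hVJ⟩ := exists_sign_isSO hV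
  replace hd : Mᵀ * M * (V * Matrix.diagonal J).map (algebraMap ℝ ℂ) =
      (V * Matrix.diagonal J).map (algebraMap ℝ ℂ) * Matrix.diagonal d := by
    rw [Matrix.map_mul, ← Matrix.mul_assoc, hd, Matrix.mul_assoc, Matrix.mul_assoc,
      Matrix.diagonal_map (map_zero _), Matrix.diagonal_mul_diagonal,
      Matrix.diagonal_mul_diagonal]
    simp only [mul_comm]
  generalize V * Matrix.diagonal J = V at *
  set W := V.map (algebraMap ℝ ℂ) with hW
  have hWt : Wᵀ * W = 1 := transpose_mul_map_algebraMap.mpr hVJ.1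
  have hWh : Wᴴ = Wᵀ := by ext i j; simp [W]
  have hn : ∀ i, ‖d i‖ = 1 := by
    intro i
    have h : (Mᵀ * M * W)ᴴ * (Mᵀ * M * W) = 1 := by
      rw [Matrix.conjTranspose_mul, Matrix.mul_assoc, ← Matrix.mul_assoc (Mᵀ * M)ᴴ, hS,
        Matrix.one_mul, hWh, hWt]
    rw [hd, Matrix.conjTranspose_mul, Matrix.mul_assoc, ← Matrix.mul_assoc Wᴴ, hWh, hWt,
      Matrix.one_mul, Matrix.diagonal_conjTranspose, Matrix.diagonal_mul_diagonal] at h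
    have h' := congrFun (congrFun h i) i
    rw [Matrix.diagonal_apply_eq, Matrix.one_apply_eq, Pi.star_apply, Complex.star_def,
      ← Complex.normSq_eq_conj_mul_self, Complex.normSq_eq_norm_sq] at h'
    have h'' : ‖d i‖ ^ 2 = 1 := by exact_mod_cast h'
    exact (pow_eq_one_iff_of_nonneg (norm_nonneg _) two_ne_zero).mp h''
  -- Half the argument, so that `D` is a square root of `diagonal d`.
  let δ : Fin 4 → ℝ := fun i => (d i).arg / 2
  let E : Matrix (Fin 4) (Fin 4) ℂ := Matrix.diagonal fun i => Complex.exp (-(Complex.I * δ i))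
  let D : Matrix (Fin 4) (Fin 4) ℂ := Matrix.diagonal fun i => Complex.exp (Complex.I * δ i)
  have hED : E * D = 1 := by
    simp [E, D, Matrix.diagonal_mul_diagonal, ← Complex.exp_add]
  have hEh : Eᴴ = D := by
    simp only [E, D, Matrix.diagonal_conjTranspose]
    congr 1
    ext i
    simp [← Complex.exp_conj]
  have hDD : Matrix.diagonal d = D * D := by
    simp only [D, Matrix.diagonal_mul_diagonal]
    congr 1
    ext i
    have h := Complex.norm_mul_exp_arg_mul_I (d i)
    rw [hn, Complex.ofReal_one, one_mul] at h
    rw [← Complex.exp_add, ← h]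
    congr 1
    simp only [δ]
    push_cast
    ring
  -- `K` is both complex orthogonal and unitary, so `Kᴴ = Kᵀ` and `K` is real.
  let K := M * W * E
  have hKt : Kᵀ * K = 1 := by
    have h : Kᵀ * K = E * (Wᵀ * (Mᵀ * M * W)) * E := by
      simp only [K, E, Matrix.transpose_mul, Matrix.diagonal_transpose, Matrix.mul_assoc]
    rw [h, hd, ← Matrix.mul_assoc Wᵀ, hWt, Matrix.one_mul, hDD, ← Matrix.mul_assoc E, hED,
      Matrix.one_mul, mul_eq_one_comm.mp hED]
  have hKh : Kᴴ * K = 1 := by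
    have h : Kᴴ * K = Eᴴ * (Wᴴ * (Mᴴ * M) * W) * E := by
      simp only [K, Matrix.conjTranspose_mul, Matrix.mul_assoc]
    rw [h, hM, Matrix.mul_one, hWh, hWt, Matrix.mul_one, hEh, mul_eq_one_comm.mp hED]
  have hK : Kᴴ = Kᵀ := by
    rw [← Matrix.mul_one Kᴴ, ← mul_eq_one_comm.mp hKt, ← Matrix.mul_assoc, hKh, Matrix.one_mul]
  obtain ⟨P, hP⟩ : ∃ P : Matrix (Fin 4) (Fin 4) ℝ, P.map (algebraMap ℝ ℂ) = K := by
    refine ⟨K.map Complex.re, ?_⟩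
    ext i j
    exact Complex.conj_eq_iff_re.mp (congrFun (congrFun hK j) i)
  obtain ⟨J', hJ', hPJ⟩ := exists_sign_isSO (transpose_mul_map_algebraMap.mp (hP ▸ hKt))
  have hR : IsSO Vᵀ := ⟨by rw [Matrix.transpose_transpose, mul_eq_one_comm.mp hVJ.1],
    by rw [Matrix.det_transpose, hVJ.2]⟩
  -- A column sign introduced to make `P` special is undone by adding `π` to the corresponding
  -- phase.
  refine ⟨_, _, fun i => if J' i = 1 then δ i else δ i + Real.pi, hPJ, hR, ?_⟩
  have hD : (Matrix.diagonal J').map (algebraMap ℝ ℂ) * Matrix.diagonal (fun i => Complex.exp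
      (Complex.I * ((if J' i = 1 then δ i else δ i + Real.pi : ℝ) : ℂ))) = D := by
    rw [Matrix.diagonal_map (map_zero _), Matrix.diagonal_mul_diagonal]
    simp only [D]
    congr 1
    ext i
    rcases hJ' i with h | h
    · simp [h]
    · have h1 : ¬ (-1 : ℝ) = 1 := by norm_num
      simp [h, h1, mul_add, Complex.exp_add, mul_comm Complex.I (Real.pi : ℂ)]
  rw [Matrix.map_mul, Matrix.mul_assoc (P.map _), hD, hP, Matrix.transpose_map, ← hW,
    Matrix.mul_assoc (M * W), hED, Matrix.mul_one, Matrix.mul_assoc, mul_eq_one_comm.mp hWt,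
    Matrix.mul_one]

end TwoQubit

end

theorem theorem1 (U : Matrix (Fin 4) (Fin 4) ℂ) (hU : U ∈ Matrix.unitaryGroup (Fin 4) ℂ) :
    ∃ c : TwoQubit.Circuit,
      TwoQubit.Circuit.gateCount c ≤ 23 ∧
      TwoQubit.Circuit.cnotCount c ≤ 4 ∧
      ∃ φ : ℝ, U = Complex.exp (Complex.I * φ) • TwoQubit.Circuit.matrix c := by
  open TwoQubit in
  have hQ := magic_mul_conjTranspose
  have hU' : Uᴴ * U = 1 := Matrix.mem_unitaryGroup_iff'.mp hU
  have hM : (magicᴴ * U * magic)ᴴ * (magicᴴ * U * magic) = 1 := by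
    have h : (magicᴴ * U * magic)ᴴ * (magicᴴ * U * magic) =
        magicᴴ * (Uᴴ * (magic * magicᴴ) * U) * magic := by
      simp only [Matrix.conjTranspose_mul, Matrix.conjTranspose_conjTranspose, Matrix.mul_assoc]
    rw [h, hQ, Matrix.mul_one, hU', Matrix.mul_one, mul_eq_one_comm.mp hQ]
  obtain ⟨P, R, δ, hP, hR, h⟩ := exists_isSO_mul_diagonal_mul hM
  obtain ⟨A, B, hA, hB, hAB⟩ := hP.isLocal
  obtain ⟨A', B', hA', hB', hAB'⟩ := hR.isLocal
  have hreal := ((hA.realizable_tensor hB).mul (realizable_magic_diagonal δ)).mul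
    (hA'.realizable_tensor hB')
  have e : U = tensor A B * (magic * Matrix.diagonal (fun i => Complex.exp (Complex.I * δ i)) *
      magicᴴ) * tensor A' B' := by
    have e1 : tensor A' B' = magic * R.map (algebraMap ℝ ℂ) * magicᴴ := by
      rw [hAB', Matrix.mul_assoc, hQ, Matrix.mul_one]
    have e2 : U = magic * (magicᴴ * U * magic) * magicᴴ := by
      simp only [← Matrix.mul_assoc, hQ, Matrix.one_mul]
      rw [Matrix.mul_assoc, hQ, Matrix.mul_one]
    rw [e1, e2, h]
    simp only [← Matrix.mul_assoc, ← hAB]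
    simp only [Matrix.mul_assoc, mul_eq_one_comm.mp hQ, Matrix.one_mul]
  rw [← e] at hreal
  obtain ⟨c, hc, hc', hφ⟩ := hreal
  -- The count is `6 + 7 + 6 = 19`, within the bound 23.
  exact ⟨c, hc.trans (by norm_num), hc', hφ⟩
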